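/- Let $\mathbb K\in\{\mathbb R,\mathbb C\}$ be the scalar field. For a Banach space $E$ and $1\le p<\infty$, a sequence $(x_n)$ in $E$ is called \emph{weakly $p$-summable} if $(f(x_n))_n\in\ell_p$ for every $f\in E^*$. A bounded set $A\subseteq E$ is called a \emph{weakly-$p$-Dunford--Pettis set} if for every weakly $p$-summable sequence $(f_n)$ in $E^*$ one has $\sup_{x\in A}|f_n(x)|\to 0$ as $n\to\infty$. The space $E$ has \emph{property $RDP^*_p$} if every weakly-$p$-Dunford--Pettis subset of $E$ is relatively weakly compact. Theorem. Let $1<p<\infty$, let $X$ be a Banach space, and let $Y$ be a closed subspace of $X$ that is reflexive (as a Banach space with the norm of $X$). If the quotient Banach space $X/Y$ has property $RDP^*_p$, then $X$ has property $RDP^*_p$. -/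

import Mathlib

open Filter Topology
open scoped ENNReal

section RDPStar

/-- The sequence `x` is weakly `p`-summable: `(f (x n))` lies in `ℓ_p` for every continuous
linear functional `f`. -/
def WeaklyPSummable (𝕜 : Type*) {E : Type*} [RCLike 𝕜] [NormedAddCommGroup E] [NormedSpace 𝕜 E]
    (p : ℝ≥0∞) (x : ℕ → E) : Prop :=
  ∀ f : StrongDual 𝕜 E, Memℓp (fun n => f (x n)) p

/-- A bounded set `A` is weakly-`p`-Dunford-Pettis if every weakly `p`-summable sequence in the
dual tends to `0` uniformly on `A`. The supremum is taken in `[0, ∞]`. -/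
def IsWeaklyPDunfordPettis (𝕜 : Type*) {E : Type*} [RCLike 𝕜] [NormedAddCommGroup E]
    [NormedSpace 𝕜 E] (p : ℝ≥0∞) (A : Set E) : Prop :=
  Bornology.IsBounded A ∧
    ∀ f : ℕ → StrongDual 𝕜 E, WeaklyPSummable 𝕜 p f →
      Tendsto (fun n => ⨆ x ∈ A, ‖f n x‖ₑ) atTop (𝓝 0)

/-- The closure of `A` in the weak topology of `E` is weakly compact. -/
def IsRelativelyWeaklyCompact (𝕜 : Type*) {E : Type*} [RCLike 𝕜] [NormedAddCommGroup E]
    [NormedSpace 𝕜 E] (A : Set E) : Prop :=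
  IsCompact (closure (toWeakSpace 𝕜 E '' A))

/-- Property `RDP*_p`: every weakly-`p`-Dunford-Pettis subset is relatively weakly compact. -/
def HasRDPStar (𝕜 E : Type*) [RCLike 𝕜] [NormedAddCommGroup E] [NormedSpace 𝕜 E]
    (p : ℝ≥0∞) : Prop :=
  ∀ A : Set E, IsWeaklyPDunfordPettis 𝕜 p A → IsRelativelyWeaklyCompact 𝕜 A

/-- The canonical embedding of `E` into its bidual is onto. -/
def IsReflexiveSpace (𝕜 E : Type*) [RCLike 𝕜] [NormedAddCommGroup E] [NormedSpace 𝕜 E] : Prop :=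
  Function.Surjective (NormedSpace.inclusionInDoubleDual 𝕜 E)

end RDPStar

/-! The quotient map preserves weakly-`p`-Dunford-Pettis sets, so it suffices to lift relative weak
compactness of a bounded set `A` from `X ⧸ Y`. By Banach-Alaoglu, this means that each weak-star
limit `z` of `A` in the bidual is an evaluation. The image of `z` in the bidual of `X ⧸ Y` is
evaluation at the class of some `x`; then `z - x` annihilates `Y^⊥`, so it comes from `Y** = Y`. -/

namespace RDPStar

variable {𝕜 X : Type*} [RCLike 𝕜] [NormedAddCommGroup X] [NormedSpace 𝕜 X]

/-- Precomposition with a bounded operator preserves weakly `p`-summable sequences of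
functionals. -/
theorem weaklyPSummable_comp {F : Type*} [NormedAddCommGroup F] [NormedSpace 𝕜 F] {p : ℝ≥0∞}
    {f : ℕ → StrongDual 𝕜 F} (hf : WeaklyPSummable 𝕜 p f) (T : X →L[𝕜] F) :
    WeaklyPSummable 𝕜 p (fun n => (f n).comp T) := fun φ =>
  hf (φ.comp (ContinuousLinearMap.precomp 𝕜 T))

/-- Weakly-`p`-Dunford-Pettis sets are preserved by bounded operators. -/
theorem isWeaklyPDunfordPettis_image {F : Type*} [NormedAddCommGroup F] [NormedSpace 𝕜 F]
    {p : ℝ≥0∞} {A : Set X} (hA : IsWeaklyPDunfordPettis 𝕜 p A) (T : X →L[𝕜] F) :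
    IsWeaklyPDunfordPettis 𝕜 p (T '' A) := by
  refine ⟨T.lipschitz.isBounded_image hA.1, fun f hf => ?_⟩
  simpa only [iSup_image, ContinuousLinearMap.comp_apply] using
    hA.2 _ (weaklyPSummable_comp hf T)

/-- If `Y` is reflexive, an element of the bidual of `X` that annihilates the functionals
vanishing on `Y` is the evaluation at an element of `Y`. -/
theorem exists_eval_of_annihilates {Y : Submodule 𝕜 X} (hY : IsReflexiveSpace 𝕜 Y)
    (z : StrongDual 𝕜 (StrongDual 𝕜 X))
    (hz : ∀ f : StrongDual 𝕜 X, (∀ y ∈ Y, f y = 0) → z f = 0) :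
    ∃ y ∈ Y, ∀ f : StrongDual 𝕜 X, z f = f y := by
  -- `ext` need not be linear, but `z ∘ ext` is, since `z f` depends only on `f` restricted to `Y`.
  choose ext hext hnorm using fun g : StrongDual 𝕜 Y => exists_extension_norm_eq Y g
  have hz' : ∀ f g : StrongDual 𝕜 X, (∀ y ∈ Y, f y = g y) → z f = z g := fun f g h => by
    rw [← sub_eq_zero, ← map_sub]
    exact hz _ fun y hy => by simp [h y hy]
  let w : StrongDual 𝕜 (StrongDual 𝕜 Y) :=
    LinearMap.mkContinuous
      { toFun := fun g => z (ext g)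
        map_add' := fun g h => by
          rw [← map_add]
          refine hz' _ _ fun y hy => ?_
          simpa using (hext (g + h) ⟨y, hy⟩).trans
            (congrArg₂ (· + ·) (hext g ⟨y, hy⟩) (hext h ⟨y, hy⟩)).symm
        map_smul' := fun c g => by
          rw [RingHom.id_apply, ← map_smul]
          refine hz' _ _ fun y hy => ?_
          simpa using (hext (c • g) ⟨y, hy⟩).trans
            (congrArg (c • ·) (hext g ⟨y, hy⟩)).symm }
      ‖z‖ fun g => (z.le_opNorm _).trans_eq (by rw [hnorm])
  obtain ⟨y, hy⟩ := hY w
  refine ⟨y, y.2, fun f => ?_⟩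
  have h : z (ext (f.comp Y.subtypeL)) = f y :=
    (congrArg (fun v => v (f.comp Y.subtypeL)) hy).symm
  rw [← h]
  exact hz' _ _ fun x hx => (hext (f.comp Y.subtypeL) ⟨x, hx⟩).symm

/-- The weak-star closure in the bidual of a relatively weakly compact set consists of
evaluations. -/
theorem closure_image_subset_range {A : Set X} (hA : IsRelativelyWeaklyCompact 𝕜 A) :
    closure (NormedSpace.inclusionInDoubleDualWeak 𝕜 X '' (toWeakSpace 𝕜 X '' A)) ⊆
      Set.range (NormedSpace.inclusionInDoubleDualWeak 𝕜 X) :=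
  (closure_minimal (Set.image_mono subset_closure)
    (hA.image (NormedSpace.inclusionInDoubleDualWeak 𝕜 X).continuous).isClosed).trans
    (Set.image_subset_range _ _)

/-- Relative weak compactness of a bounded set can be checked in the quotient by a reflexive
subspace. -/
theorem isRelativelyWeaklyCompact_of_quotient (Y : Submodule 𝕜 X) [IsClosed (Y : Set X)]
    (hY : IsReflexiveSpace 𝕜 Y) {A : Set X} (hb : Bornology.IsBounded A)
    (hA : IsRelativelyWeaklyCompact 𝕜 (Y.mkQL '' A)) : IsRelativelyWeaklyCompact 𝕜 A := by
  have hb' : Bornology.IsBounded (toWeakSpace 𝕜 X ⁻¹' (toWeakSpace 𝕜 X '' A)) := by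
    rwa [Set.preimage_image_eq _ (toWeakSpace 𝕜 X).injective]
  refine NormedSpace.isCompact_closure_of_isBounded 𝕜 X _ hb' fun z hz => ?_
  let R : StrongDual 𝕜 (X ⧸ Y) →L[𝕜] StrongDual 𝕜 X := ContinuousLinearMap.precomp 𝕜 Y.mkQL
  -- `S` is the second adjoint of the quotient map, hence weak-star continuous.
  let S : WeakDual 𝕜 (StrongDual 𝕜 X) → WeakDual 𝕜 (StrongDual 𝕜 (X ⧸ Y)) :=
    fun v => StrongDual.toWeakDual ((WeakDual.toStrongDual v).comp R)
  have hS : Continuous S :=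
    WeakDual.continuous_of_continuous_eval fun g => WeakDual.eval_continuous (R g)
  have hSz : S z ∈ closure (NormedSpace.inclusionInDoubleDualWeak 𝕜 (X ⧸ Y) ''
      (toWeakSpace 𝕜 (X ⧸ Y) '' (Y.mkQL '' A))) := by
    refine map_mem_closure hS hz ?_
    rintro _ ⟨_, ⟨a, ha, rfl⟩, rfl⟩
    exact ⟨_, ⟨_, ⟨a, ha, rfl⟩, rfl⟩, rfl⟩
  obtain ⟨q, hq⟩ := closure_image_subset_range hA hSz
  obtain ⟨x, hx⟩ := Y.mkQ_surjective ((toWeakSpace 𝕜 (X ⧸ Y)).symm q)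
  have key : ∀ g : StrongDual 𝕜 (X ⧸ Y), z (R g) = g (Y.mkQ x) := fun g => by
    rw [hx]
    exact (congrArg (fun v : WeakDual 𝕜 (StrongDual 𝕜 (X ⧸ Y)) => v g) hq).symm
  obtain ⟨y, -, hy⟩ := exists_eval_of_annihilates hY
    (WeakDual.toStrongDual z - NormedSpace.inclusionInDoubleDual 𝕜 X x) fun f hf => by
      -- Functionals vanishing on `Y` factor through `X ⧸ Y`, where `key` applies.
      have hfR : R (Y.liftQL f hf) = f := by
        ext v
        rfl
      have h := key (Y.liftQL f hf)
      rw [hfR] at h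
      exact sub_eq_zero.2 h
  refine ⟨toWeakSpace 𝕜 X (x + y), DFunLike.ext _ _ fun f => ?_⟩
  have h : z f - f x = f y := hy f
  change f (x + y) = z f
  rw [map_add, ← h, add_sub_cancel]

end RDPStar

theorem mainTheorem12 {𝕜 X : Type*} [RCLike 𝕜] [NormedAddCommGroup X] [NormedSpace 𝕜 X]
    [CompleteSpace X] (p : ℝ≥0∞) (hp : 1 < p) (hp' : p < ∞)
    (Y : Submodule 𝕜 X) [IsClosed (Y : Set X)] (hY : IsReflexiveSpace 𝕜 Y)
    (hXY : HasRDPStar 𝕜 (X ⧸ Y) p) :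
    HasRDPStar 𝕜 X p := fun _ hA =>
  RDPStar.isRelativelyWeaklyCompact_of_quotient Y hY hA.1
    (hXY _ (RDPStar.isWeaklyPDunfordPettis_image hA Y.mkQL))
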